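/- Let $R$ be a right hereditary ring (every right ideal of $R$ is a projective right $R$-module) and let $\Sigma$ be a set of maps between finitely generated projective right $R$-modules. Let $R\to R_\Sigma$ be the universal localisation of $R$ at $\Sigma$, that is, the universal ring homomorphism such that $\sigma\otimes_R R_\Sigma$ is invertible for every $\sigma\in\Sigma$. Let $\mathcal S(\Sigma)$, the category of $R_\Sigma$-trivial modules, be the full subcategory of the category $\mathrm{fp\text{-}mod}\,R$ of finitely presented right $R$-modules whose objects are those finitely presented modules $M$ of homological dimension at most $1$ such that $\operatorname{Hom}_R(M,N)=0=\operatorname{Ext}^1_R(M,N)$ for every right $R_\Sigma$-module $N$, considered as an $R$-module along $R\to R_\Sigma$. Then $\mathcal S(\Sigma)$ is an exact abelian subcategory of $\mathrm{fp\text{-}mod}\,R$: it is an abelian category and its inclusion into $\mathrm{fp\text{-}mod}\,R$ is exact; equivalently, it is an additive subcategory (it contains $0$ and finite direct sums) and contains the kernel, the cokernel and the image of each of its maps, these being formed in the category of right $R$-modules. Moreover $\mathcal S(\Sigma)$ is closed under extensions: if $0\to A\to B\to C\to 0$ is a short exact sequence of right $R$-modules with $A$ and $C$ in $\mathcal S(\Sigma)$,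 then $B$ is in $\mathcal S(\Sigma)$. -/

import Mathlib

open CategoryTheory CategoryTheory.Limits
open scoped TensorProduct

universe u v

/- Right modules over a ring `R` are modules over `Rᵐᵒᵖ`: `x · r` is `MulOpposite.op r • x`. -/

namespace UnivLoc

/-- A ring is right hereditary if each of its right ideals is a projective right module. -/
def IsRightHereditary (R : Type u) [Ring R] : Prop :=
  ∀ I : Submodule Rᵐᵒᵖ R, Module.Projective Rᵐᵒᵖ I

/-- A map between finitely generated projective right `R`-modules. -/
structure ProjMap (R : Type u) [Ring R] : Type (u + 1) where
  source : ModuleCat.{u} Rᵐᵒᵖ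
  target : ModuleCat.{u} Rᵐᵒᵖ
  source_finite : Module.Finite Rᵐᵒᵖ source
  source_projective : Module.Projective Rᵐᵒᵖ source
  target_finite : Module.Finite Rᵐᵒᵖ target
  target_projective : Module.Projective Rᵐᵒᵖ target
  map : source →ₗ[Rᵐᵒᵖ] target

/-! ### The universal localisation

A two-sided inverse of `σ ⊗ S`, for `σ : P → Q` a map between finitely generated projective
right `R`-modules and `R → S` a ring homomorphism, is an `R`-linear map `Q → P ⊗ S`, that is, a
family of elements `[ξ, q]` of `S`, for `ξ` in the left module `P* = Hom(P, R)` and `q` in `Q`,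
that is additive and `R`-linear in both variables, and is subject to `[ξ, σ p] = ξ p` and
`[η ∘ σ, q] = η q`. The ring `R_Σ` is presented by these generators and relations over `R`.
That it has the universal property is proved below. -/

section Construction

variable {R : Type u} [Ring R] {ι : Type u} (Sig : ι → ProjMap R)

/-- Generators of `R_Σ`: the elements of `R`, and the symbols `[ξ, q]`. -/
inductive Gen : Type u
  | coe (r : R) : Gen
  | inv (i : ι) (ξ : (Sig i).source →ₗ[Rᵐᵒᵖ] R) (q : (Sig i).target) : Gen

/-- An element of `R` in the free ring on the generators. -/
abbrev Gen.c (r : R) : FreeAlgebra ℤ (Gen Sig) := FreeAlgebra.ι ℤ (Gen.coe r)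

/-- A symbol `[ξ, q]` in the free ring on the generators. -/
abbrev Gen.t (i : ι) (ξ : (Sig i).source →ₗ[Rᵐᵒᵖ] R) (q : (Sig i).target) :
    FreeAlgebra ℤ (Gen Sig) := FreeAlgebra.ι ℤ (Gen.inv i ξ q)

/-- Defining relations of `R_Σ`. -/
inductive Rel : FreeAlgebra ℤ (Gen Sig) → FreeAlgebra ℤ (Gen Sig) → Prop
  | coe_one : Rel (Gen.c Sig 1) 1
  | coe_mul (r s : R) : Rel (Gen.c Sig (r * s)) (Gen.c Sig r * Gen.c Sig s)
  | coe_add (r s : R) : Rel (Gen.c Sig (r + s)) (Gen.c Sig r + Gen.c Sig s)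
  | inv_add_left (i : ι) (ξ ξ' : (Sig i).source →ₗ[Rᵐᵒᵖ] R) (q : (Sig i).target) :
      Rel (Gen.t Sig i (ξ + ξ') q) (Gen.t Sig i ξ q + Gen.t Sig i ξ' q)
  | inv_add_right (i : ι) (ξ : (Sig i).source →ₗ[Rᵐᵒᵖ] R) (q q' : (Sig i).target) :
      Rel (Gen.t Sig i ξ (q + q')) (Gen.t Sig i ξ q + Gen.t Sig i ξ q')
  | inv_smul_left (i : ι) (r : R) (ξ : (Sig i).source →ₗ[Rᵐᵒᵖ] R) (q : (Sig i).target) :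
      Rel (Gen.t Sig i (r • ξ) q) (Gen.c Sig r * Gen.t Sig i ξ q)
  | inv_smul_right (i : ι) (r : R) (ξ : (Sig i).source →ₗ[Rᵐᵒᵖ] R) (q : (Sig i).target) :
      Rel (Gen.t Sig i ξ (MulOpposite.op r • q)) (Gen.t Sig i ξ q * Gen.c Sig r)
  | inv_map (i : ι) (ξ : (Sig i).source →ₗ[Rᵐᵒᵖ] R) (p : (Sig i).source) :
      Rel (Gen.t Sig i ξ ((Sig i).map p)) (Gen.c Sig (ξ p))
  | inv_comp (i : ι) (η : (Sig i).target →ₗ[Rᵐᵒᵖ] R) (q : (Sig i).target) :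
      Rel (Gen.t Sig i (η.comp (Sig i).map) q) (Gen.c Sig (η q))

/-- The universal localisation `R_Σ` of `R` at the set of maps `Σ`. -/
abbrev UnivLocalisation : Type u := RingQuot (Rel Sig)

/-- The image in `R_Σ` of the symbol `[ξ, q]`. -/
noncomputable def sym (i : ι) (ξ : (Sig i).source →ₗ[Rᵐᵒᵖ] R) (q : (Sig i).target) :
    UnivLocalisation Sig := RingQuot.mkRingHom (Rel Sig) (Gen.t Sig i ξ q)

/-- The canonical ring homomorphism `R → R_Σ`. -/
noncomputable def toUnivLocalisation : R →+* UnivLocalisation Sig :=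
  RingHom.mk' ⟨⟨fun r => RingQuot.mkRingHom (Rel Sig) (Gen.c Sig r),
      (RingQuot.mkRingHom_rel .coe_one).trans (map_one _)⟩,
      fun r s => (RingQuot.mkRingHom_rel (.coe_mul r s)).trans (map_mul _ _ _)⟩
    fun r s => (RingQuot.mkRingHom_rel (.coe_add r s)).trans (map_add _ _ _)

end Construction

/-! ### The universal property -/

section UniversalProperty

variable {R : Type u} [Ring R] {T : Type v} [Ring T] (φ : R →+* T)

/-- The subgroup of `P ⊗[ℤ] T` generated by all `p r ⊗ t - p ⊗ φ(r) t`. -/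
def balancing (P : Type u) [AddCommGroup P] [Module Rᵐᵒᵖ P] : AddSubgroup (P ⊗[ℤ] T) :=
  AddSubgroup.closure
    {x | ∃ (p : P) (r : R) (t : T), x = (MulOpposite.op r • p) ⊗ₜ[ℤ] t - p ⊗ₜ[ℤ] (φ r * t)}

/-- The abelian group `P ⊗_R T`, for a right `R`-module `P` and a ring `T` over `R`. -/
abbrev BaseChange (P : Type u) [AddCommGroup P] [Module Rᵐᵒᵖ P] : Type (max u v) :=
  (P ⊗[ℤ] T) ⧸ balancing φ P

namespace BaseChange

variable {P Q : Type u} [AddCommGroup P] [Module Rᵐᵒᵖ P] [AddCommGroup Q] [Module Rᵐᵒᵖ Q]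

/-- The element `p ⊗ t`. -/
def mk (p : P) (t : T) : BaseChange φ P := QuotientAddGroup.mk (p ⊗ₜ[ℤ] t)

lemma mk_add_left (p p' : P) (t : T) : mk φ (p + p') t = mk φ p t + mk φ p' t := by
  simp [mk, TensorProduct.add_tmul]

lemma mk_add_right (p : P) (t t' : T) : mk φ p (t + t') = mk φ p t + mk φ p t' := by
  simp [mk, TensorProduct.tmul_add]

lemma mk_smul (p : P) (r : R) (t : T) : mk φ (MulOpposite.op r • p) t = mk φ p (φ r * t) := by
  refine (QuotientAddGroup.eq_iff_sub_mem).2 (AddSubgroup.subset_closure ⟨p, r, t, rfl⟩)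

lemma mk_sum_left {n : ℕ} (p : Fin n → P) (t : T) :
    mk φ (∑ i, p i) t = ∑ i, mk φ (p i) t :=
  map_sum (AddMonoidHom.mk' (fun x => mk φ x t) fun _ _ => mk_add_left φ _ _ _) _ _

lemma mk_sum_right {n : ℕ} (p : P) (t : Fin n → T) :
    mk φ p (∑ i, t i) = ∑ i, mk φ p (t i) :=
  map_sum (AddMonoidHom.mk' (fun x => mk φ p x) fun _ _ => mk_add_right φ _ _ _) _ _

/-- The additive map out of `P ⊗_R T` given by a balanced biadditive map. -/
def lift {A : Type*} [AddCommGroup A] (f : P → T → A)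
    (hl : ∀ p p' t, f (p + p') t = f p t + f p' t)
    (hr : ∀ p t t', f p (t + t') = f p t + f p t')
    (hb : ∀ p (r : R) t, f (MulOpposite.op r • p) t = f p (φ r * t)) : BaseChange φ P →+ A :=
  QuotientAddGroup.lift _
    (TensorProduct.liftAddHom
      (AddMonoidHom.mk' (fun p => AddMonoidHom.mk' (f p) (hr p)) fun p p' => by
        ext t; exact hl p p' t)
      fun n p t => by
        have h1 : f (n • p) t = n • f p t :=
          map_zsmul (AddMonoidHom.mk' (fun x => f x t) fun _ _ => hl _ _ _) n p
        have h2 : f p (n • t) = n • f p t := map_zsmul (AddMonoidHom.mk' (f p) (hr p)) n t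
        exact h1.trans h2.symm)
    ((AddSubgroup.closure_le _).2 (by
      rintro _ ⟨p, r, t, rfl⟩
      rw [SetLike.mem_coe, AddMonoidHom.mem_ker, map_sub]
      exact sub_eq_zero.2 (hb p r t)))

@[simp] lemma lift_mk {A : Type*} [AddCommGroup A] (f : P → T → A) (hl hr hb) (p : P) (t : T) :
    lift φ f hl hr hb (mk φ p t) = f p t := rfl

lemma hom_ext {A : Type*} [AddCommGroup A] {f g : BaseChange φ P →+ A}
    (h : ∀ p t, f (mk φ p t) = g (mk φ p t)) : f = g := by
  refine QuotientAddGroup.addMonoidHom_ext _ ?_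
  ext x
  induction x using TensorProduct.induction_on with
  | zero => simp
  | tmul p t => exact h p t
  | add a b ha hb => simp only [map_add, ha, hb]

/-- The map `f ⊗ T`. -/
def map (f : P →ₗ[Rᵐᵒᵖ] Q) : BaseChange φ P →+ BaseChange φ Q :=
  lift φ (fun p t => mk φ (f p) t) (fun _ _ _ => by rw [map_add, mk_add_left])
    (fun _ _ _ => mk_add_right φ _ _ _) (fun _ _ _ => by rw [map_smul, mk_smul])

@[simp] lemma map_mk (f : P →ₗ[Rᵐᵒᵖ] Q) (p : P) (t : T) :
    map φ f (mk φ p t) = mk φ (f p) t := lift_mk φ _ _ _ _ _ _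

/-- Multiplication on the right by an element of `T`. -/
def rmul (s : T) : BaseChange φ P →+ BaseChange φ P :=
  lift φ (fun p t => mk φ p (t * s)) (fun _ _ _ => mk_add_left φ _ _ _)
    (fun _ _ _ => by rw [add_mul, mk_add_right])
    (fun _ _ _ => by rw [mk_smul, mul_assoc])

@[simp] lemma rmul_mk (s : T) (p : P) (t : T) : rmul φ s (mk φ p t) = mk φ p (t * s) :=
  lift_mk φ _ _ _ _ _ _

lemma map_rmul (f : P →ₗ[Rᵐᵒᵖ] Q) (s : T) (x : BaseChange φ P) :
    map φ f (rmul φ s x) = rmul φ s (map φ f x) :=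
  DFunLike.congr_fun (hom_ext φ (f := (map φ f).comp (rmul φ s))
    (g := (rmul φ s).comp (map φ f)) fun p t => by simp) x

/-- The map `ξ ⊗ T : P ⊗_R T → R ⊗_R T = T`. -/
def ev (ξ : P →ₗ[Rᵐᵒᵖ] R) : BaseChange φ P →+ T :=
  lift φ (fun p t => φ (ξ p) * t) (fun _ _ _ => by rw [map_add, map_add, add_mul])
    (fun _ _ _ => mul_add _ _ _) (fun _ _ _ => by simp [mul_assoc])

@[simp] lemma ev_mk (ξ : P →ₗ[Rᵐᵒᵖ] R) (p : P) (t : T) : ev φ ξ (mk φ p t) = φ (ξ p) * t :=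
  lift_mk φ _ _ _ _ _ _

lemma ev_rmul (ξ : P →ₗ[Rᵐᵒᵖ] R) (s : T) (x : BaseChange φ P) :
    ev φ ξ (rmul φ s x) = ev φ ξ x * s :=
  DFunLike.congr_fun (hom_ext φ (f := (ev φ ξ).comp (rmul φ s))
    (g := (AddMonoidHom.mulRight s).comp (ev φ ξ)) fun p t => by simp [mul_assoc]) x

lemma ev_add (ξ ξ' : P →ₗ[Rᵐᵒᵖ] R) (x : BaseChange φ P) :
    ev φ (ξ + ξ') x = ev φ ξ x + ev φ ξ' x :=
  DFunLike.congr_fun (hom_ext φ (f := ev φ (ξ + ξ'))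
    (g := ev φ ξ + ev φ ξ') fun p t => by simp [add_mul]) x

lemma ev_smul (r : R) (ξ : P →ₗ[Rᵐᵒᵖ] R) (x : BaseChange φ P) :
    ev φ (r • ξ) x = φ r * ev φ ξ x :=
  DFunLike.congr_fun (hom_ext φ (f := ev φ (r • ξ))
    (g := (AddMonoidHom.mulLeft (φ r)).comp (ev φ ξ)) fun p t => by simp [mul_assoc]) x

lemma ev_comp (f : P →ₗ[Rᵐᵒᵖ] Q) (η : Q →ₗ[Rᵐᵒᵖ] R) (x : BaseChange φ P) :
    ev φ (η.comp f) x = ev φ η (map φ f x) :=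
  DFunLike.congr_fun (hom_ext φ (f := ev φ (η.comp f))
    (g := (ev φ η).comp (map φ f)) fun p t => by simp) x

end BaseChange

variable {ι : Type u} (Sig : ι → ProjMap R)

/-- `φ : R → T` inverts `Σ` if `σ ⊗ T` is invertible for every `σ` in `Σ`. -/
def IsInverting : Prop := ∀ i, Function.Bijective (BaseChange.map φ (Sig i).map)

lemma exists_dual_basis (P : Type u) [AddCommGroup P] [Module Rᵐᵒᵖ P] [Module.Finite Rᵐᵒᵖ P]
    [Module.Projective Rᵐᵒᵖ P] : ∃ (n : ℕ) (p : Fin n → P) (ξ : Fin n → P →ₗ[Rᵐᵒᵖ] R),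
      ∀ x, ∑ i, MulOpposite.op (ξ i x) • p i = x := by
  obtain ⟨n, f, g, -, -, h⟩ := Module.Finite.exists_comp_eq_id_of_projective Rᵐᵒᵖ P
  refine ⟨n, fun i => f (Pi.single i 1), fun i =>
    { toFun := fun x => (g x i).unop, map_add' := by simp, map_smul' := by simp }, fun x => ?_⟩
  simp only [LinearMap.coe_mk, AddHom.coe_mk, MulOpposite.op_unop, ← map_smul, ← map_sum]
  rw [show ∑ i, g x i • (Pi.single i 1 : Fin n → Rᵐᵒᵖ) = g x from ?_]
  · exact DFunLike.congr_fun h x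
  · ext j
    simp [Finset.sum_apply, Pi.single_apply]

section Sym

lemma sym_add_left (i : ι) (ξ ξ' : (Sig i).source →ₗ[Rᵐᵒᵖ] R) (q : (Sig i).target) :
    sym Sig i (ξ + ξ') q = sym Sig i ξ q + sym Sig i ξ' q :=
  (RingQuot.mkRingHom_rel (.inv_add_left i ξ ξ' q)).trans (map_add _ _ _)

lemma sym_add_right (i : ι) (ξ : (Sig i).source →ₗ[Rᵐᵒᵖ] R) (q q' : (Sig i).target) :
    sym Sig i ξ (q + q') = sym Sig i ξ q + sym Sig i ξ q' :=
  (RingQuot.mkRingHom_rel (.inv_add_right i ξ q q')).trans (map_add _ _ _)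

lemma sym_smul_left (i : ι) (r : R) (ξ : (Sig i).source →ₗ[Rᵐᵒᵖ] R) (q : (Sig i).target) :
    sym Sig i (r • ξ) q = toUnivLocalisation Sig r * sym Sig i ξ q :=
  (RingQuot.mkRingHom_rel (.inv_smul_left i r ξ q)).trans (map_mul _ _ _)

lemma sym_smul_right (i : ι) (r : R) (ξ : (Sig i).source →ₗ[Rᵐᵒᵖ] R) (q : (Sig i).target) :
    sym Sig i ξ (MulOpposite.op r • q) = sym Sig i ξ q * toUnivLocalisation Sig r :=
  (RingQuot.mkRingHom_rel (.inv_smul_right i r ξ q)).trans (map_mul _ _ _)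

lemma sym_map (i : ι) (ξ : (Sig i).source →ₗ[Rᵐᵒᵖ] R) (p : (Sig i).source) :
    sym Sig i ξ ((Sig i).map p) = toUnivLocalisation Sig (ξ p) :=
  RingQuot.mkRingHom_rel (.inv_map i ξ p)

lemma sym_comp (i : ι) (η : (Sig i).target →ₗ[Rᵐᵒᵖ] R) (q : (Sig i).target) :
    sym Sig i (η.comp (Sig i).map) q = toUnivLocalisation Sig (η q) :=
  RingQuot.mkRingHom_rel (.inv_comp i η q)

lemma sym_sum {n : ℕ} (i : ι) (r : Fin n → R) (ξ : Fin n → (Sig i).source →ₗ[Rᵐᵒᵖ] R)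
    (q : (Sig i).target) : sym Sig i (∑ k, r k • ξ k) q =
      ∑ k, toUnivLocalisation Sig (r k) * sym Sig i (ξ k) q := by
  simp only [← sym_smul_left]
  exact map_sum (AddMonoidHom.mk' (fun x => sym Sig i x q) fun _ _ => sym_add_left Sig _ _ _ _) _ _

end Sym

lemma dual_expand {P : Type u} [AddCommGroup P] [Module Rᵐᵒᵖ P] {n : ℕ} {p : Fin n → P}
    {ξ : Fin n → P →ₗ[Rᵐᵒᵖ] R} (h : ∀ x, ∑ i, MulOpposite.op (ξ i x) • p i = x)
    (ζ : P →ₗ[Rᵐᵒᵖ] R) : ∑ k, ζ (p k) • ξ k = ζ := by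
  ext x
  conv_rhs => rw [← h x]
  simp [map_sum]

/-- If `ψ ∘ (R → R_Σ) = φ`, then `∑ pₖ ⊗ ψ[ξₖ, q]` is mapped to `q ⊗ 1` by `σ ⊗ T`. -/
lemma map_sum_sym (ψ : UnivLocalisation Sig →+* T) (hψ : ψ.comp (toUnivLocalisation Sig) = φ)
    (i : ι) {n : ℕ} {p : Fin n → (Sig i).source} {ξ : Fin n → (Sig i).source →ₗ[Rᵐᵒᵖ] R}
    (h : ∀ x, ∑ k, MulOpposite.op (ξ k x) • p k = x) (q : (Sig i).target) :
    BaseChange.map φ (Sig i).map (∑ k, BaseChange.mk φ (p k) (ψ (sym Sig i (ξ k) q))) =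
      BaseChange.mk φ q 1 := by
  have hφ : ∀ r, ψ (toUnivLocalisation Sig r) = φ r := fun r => DFunLike.congr_fun hψ r
  have := (Sig i).target_finite
  have := (Sig i).target_projective
  obtain ⟨m, y, η, hη⟩ := exists_dual_basis (R := R) (Sig i).target
  have h1 : ∀ j, ∑ k, φ (η j ((Sig i).map (p k))) * ψ (sym Sig i (ξ k) q) = φ (η j q) := by
    intro j
    rw [← hφ (η j q), ← sym_comp, ← dual_expand h ((η j).comp (Sig i).map), sym_sum, map_sum]
    simp [hφ]
  calc _ = ∑ k, BaseChange.mk φ ((Sig i).map (p k)) (ψ (sym Sig i (ξ k) q)) := by simp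
    _ = ∑ k, ∑ j, BaseChange.mk φ (y j)
          (φ (η j ((Sig i).map (p k))) * ψ (sym Sig i (ξ k) q)) := by
        refine Finset.sum_congr rfl fun k _ => ?_
        conv_lhs => rw [← hη ((Sig i).map (p k)), BaseChange.mk_sum_left]
        simp only [BaseChange.mk_smul]
    _ = ∑ j, BaseChange.mk φ (y j) (φ (η j q) * 1) := by
        rw [Finset.sum_comm]
        simp only [← BaseChange.mk_sum_right, h1, mul_one]
    _ = _ := by
        simp only [← BaseChange.mk_smul, ← BaseChange.mk_sum_left, hη]

/-- `R → R_Σ` inverts `Σ`. -/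
theorem isInverting_toUnivLocalisation : IsInverting (toUnivLocalisation Sig) Sig := by
  intro i
  have := (Sig i).source_finite
  have := (Sig i).source_projective
  obtain ⟨n, p, ξ, h⟩ := exists_dual_basis (R := R) (Sig i).source
  let φ := toUnivLocalisation Sig
  have hadd : ∀ q q' : (Sig i).target, ∑ k, BaseChange.mk φ (p k) (sym Sig i (ξ k) (q + q')) =
      ∑ k, BaseChange.mk φ (p k) (sym Sig i (ξ k) q) +
        ∑ k, BaseChange.mk φ (p k) (sym Sig i (ξ k) q') := by
    intro q q'
    simp only [sym_add_right, BaseChange.mk_add_right, Finset.sum_add_distrib]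
  let g : BaseChange φ (Sig i).target →+ BaseChange φ (Sig i).source :=
    BaseChange.lift φ
      (fun q t => BaseChange.rmul φ t (∑ k, BaseChange.mk φ (p k) (sym Sig i (ξ k) q)))
      (fun q q' t => by rw [hadd, map_add])
      (fun q t t' => by simp [mul_add, BaseChange.mk_add_right, Finset.sum_add_distrib])
      (fun q r t => by simp [sym_smul_right, mul_assoc, φ])
  refine Function.bijective_iff_has_inverse.2 ⟨g, fun x => ?_, fun x => ?_⟩
  · refine DFunLike.congr_fun (BaseChange.hom_ext φ (f := g.comp (BaseChange.map φ (Sig i).map))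
      (g := AddMonoidHom.id _) fun x t => ?_) x
    simp only [AddMonoidHom.comp_apply, BaseChange.map_mk, g, BaseChange.lift_mk, sym_map,
      map_sum, BaseChange.rmul_mk, AddMonoidHom.id_apply]
    rw [show (toUnivLocalisation Sig) = φ from rfl]
    simp only [← BaseChange.mk_smul, ← BaseChange.mk_sum_left, h]
  · refine DFunLike.congr_fun (BaseChange.hom_ext φ (f := (BaseChange.map φ (Sig i).map).comp g)
      (g := AddMonoidHom.id _) fun q t => ?_) x
    have := map_sum_sym φ Sig (RingHom.id _) (RingHom.id_comp _) i h q
    simp only [RingHom.id_apply] at this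
    simp only [AddMonoidHom.comp_apply, g, BaseChange.lift_mk, AddMonoidHom.id_apply,
      BaseChange.map_rmul, this, BaseChange.rmul_mk, one_mul]

/-- Every `R → T` that inverts `Σ` factors uniquely through `R → R_Σ`. -/
theorem existsUnique_factor (hφ : IsInverting φ Sig) :
    ∃! ψ : UnivLocalisation Sig →+* T, ψ.comp (toUnivLocalisation Sig) = φ := by
  let e : ∀ i, BaseChange φ (Sig i).source ≃+ BaseChange φ (Sig i).target :=
    fun i => AddEquiv.ofBijective (BaseChange.map φ (Sig i).map) (hφ i)
  have he : ∀ i x, BaseChange.map φ (Sig i).map ((e i).symm x) = x :=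
    fun i x => (e i).apply_symm_apply x
  have he' : ∀ i x, (e i).symm (BaseChange.map φ (Sig i).map x) = x :=
    fun i x => (e i).symm_apply_apply x
  have her : ∀ i t x, (e i).symm (BaseChange.rmul φ t x) =
      BaseChange.rmul φ t ((e i).symm x) := by
    intro i t x
    apply (hφ i).1
    rw [he, BaseChange.map_rmul, he]
  let F : FreeAlgebra ℤ (Gen Sig) →+* T := (FreeAlgebra.lift ℤ (fun x : Gen Sig => match x with
    | .coe r => φ r
    | .inv i ξ q => BaseChange.ev φ ξ ((e i).symm (BaseChange.mk φ q 1)))).toRingHom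
  have Fc : ∀ r, F (Gen.c Sig r) = φ r := fun r => by simp [F, Gen.c]
  have Ft : ∀ i ξ q, F (Gen.t Sig i ξ q) =
      BaseChange.ev φ ξ ((e i).symm (BaseChange.mk φ q 1)) := fun i ξ q => by simp [F, Gen.t]
  have hF : ∀ ⦃x y⦄, Rel Sig x y → F x = F y := by
    intro x y hxy
    induction hxy with
    | coe_one => rw [Fc, map_one, map_one]
    | coe_mul r s => rw [map_mul, Fc, Fc, Fc, map_mul]
    | coe_add r s => rw [map_add, Fc, Fc, Fc, map_add]
    | inv_add_left i ξ ξ' q => rw [map_add, Ft, Ft, Ft, BaseChange.ev_add]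
    | inv_add_right i ξ q q' =>
      rw [map_add, Ft, Ft, Ft, BaseChange.mk_add_left, map_add, map_add]
    | inv_smul_left i r ξ q => rw [map_mul, Fc, Ft, Ft, BaseChange.ev_smul]
    | inv_smul_right i r ξ q =>
      rw [map_mul, Fc, Ft, Ft, BaseChange.mk_smul, mul_one, ← BaseChange.ev_rmul, ← her,
        BaseChange.rmul_mk, one_mul]
    | inv_map i ξ p =>
      rw [Ft, Fc, ← BaseChange.map_mk, he', BaseChange.ev_mk, mul_one]
    | inv_comp i η q => rw [Ft, Fc, BaseChange.ev_comp, he, BaseChange.ev_mk, mul_one]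
  refine ⟨RingQuot.lift ⟨F, hF⟩, ?_, ?_⟩
  · ext r
    exact (RingQuot.lift_mkRingHom_apply F hF _).trans (Fc r)
  · intro ψ hψ
    refine RingQuot.ringQuot_ext _ _ ?_
    have key : ∀ i ξ q, ψ (sym Sig i ξ q) =
        BaseChange.ev φ ξ ((e i).symm (BaseChange.mk φ q 1)) := by
      intro i ξ q
      have := (Sig i).source_finite
      have := (Sig i).source_projective
      obtain ⟨n, p, ζ, h⟩ := exists_dual_basis (R := R) (Sig i).source
      rw [← map_sum_sym φ Sig ψ hψ i h q, he', map_sum]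
      conv_lhs => rw [← dual_expand h ξ, sym_sum, map_sum]
      refine Finset.sum_congr rfl fun k _ => ?_
      rw [map_mul, BaseChange.ev_mk, ← hψ]
      rfl
    refine RingHom.toIntAlgHom_injective (FreeAlgebra.hom_ext (funext fun x => ?_))
    change ψ (RingQuot.mkRingHom _ (FreeAlgebra.ι ℤ x)) =
      RingQuot.lift ⟨F, hF⟩ (RingQuot.mkRingHom _ (FreeAlgebra.ι ℤ x))
    rw [RingQuot.lift_mkRingHom_apply]
    cases x with
    | coe r => exact (DFunLike.congr_fun hψ r).trans (Fc r).symm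
    | inv i ξ q => exact (key i ξ q).trans (Ft i ξ q).symm

end UniversalProperty

/-! ### Right modules trivial over the universal localisation -/

/-- The full subcategory `fp-mod R` of finitely presented right `R`-modules. -/
def fpMod (R : Type u) [Ring R] : ObjectProperty (ModuleCat.{u} Rᵐᵒᵖ) :=
  fun M => Module.FinitePresentation Rᵐᵒᵖ M

/-- `M` is left perpendicular to `N` if `Hom(M, N) = 0 = Ext(M, N)`. -/
def LeftPerp {A : Type u} [Ring A] (M N : ModuleCat.{u} A) : Prop :=
  Subsingleton (M ⟶ N) ∧ Subsingleton (Abelian.Ext.{u} M N 1)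

section

variable {R : Type u} [Ring R] {ι : Type u} (Sig : ι → ProjMap R)

/-- A right `R_Σ`-module, considered as a right `R`-module. -/
noncomputable def asRModule (N : ModuleCat.{u} (UnivLocalisation Sig)ᵐᵒᵖ) :
    ModuleCat.{u} Rᵐᵒᵖ :=
  (ModuleCat.restrictScalars (toUnivLocalisation Sig).op).obj N

/-- The category `S(Σ)` of `R_Σ`-trivial modules: the full subcategory of the finitely presented
right `R`-modules of homological dimension at most `1` that are left perpendicular to all
right `R_Σ`-modules. -/
def trivialModules : ObjectProperty (ModuleCat.{u} Rᵐᵒᵖ) := fun M =>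
  fpMod R M ∧ HasProjectiveDimensionLE M 1 ∧
    ∀ N : ModuleCat.{u} (UnivLocalisation Sig)ᵐᵒᵖ, LeftPerp M (asRModule Sig N)

end

/-- The full subcategory on `P` is an exact abelian subcategory of the full subcategory on `Q`:
it is contained in it, it is an abelian category (for the addition of morphisms inherited from
the ambient category), and the inclusion is an exact functor. -/
structure IsExactAbelianSubcategory {C : Type*} [Category* C] [Preadditive C]
    (P Q : ObjectProperty C) : Prop where
  le : P ≤ Q
  abelian : ∃ A : Abelian P.FullSubcategory,
    A.toPreadditive = (inferInstance : Preadditive P.FullSubcategory)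
  preservesFiniteLimits : PreservesFiniteLimits (ObjectProperty.ιOfLE le)
  preservesFiniteColimits : PreservesFiniteColimits (ObjectProperty.ιOfLE le)

/-- An additive subcategory of right modules (it contains `0` and finite direct sums) that
contains the kernel, the cokernel and the image of each of its maps. -/
structure IsClosedUnderKerCokerIm {A : Type u} [Ring A]
    (P : ObjectProperty (ModuleCat.{u} A)) : Prop where
  zero : P.ContainsZero
  sums : P.IsClosedUnderFiniteProducts
  kernels : P.IsClosedUnderKernels
  cokernels : P.IsClosedUnderCokernels
  images : ∀ (X Y : ModuleCat.{u} A) (f : X ⟶ Y), P X → P Y →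
    P (ModuleCat.of A (LinearMap.range f.hom))

end UnivLoc

/-! Over a hereditary ring the submodules of finite free modules are projective
(`projective_submodule_pi`). Hence every finitely generated module has projective dimension at most
1, and finitely presented modules are closed under kernels and images (coherence). For kernels,
images and cokernels, only the vanishing of Hom and Ext¹ into a fixed N is then left to check.

Let f : X → Y have kernel K, image I and cokernel C, with X and Y left perpendicular to N. Since
Ext²(C, N) = 0, the sequence 0 → I → Y → C → 0 gives Ext¹(I, N) = 0, while Hom(I, N) embeds in
Hom(X, N) = 0. So I is perpendicular to N (`leftPerp_range`), and the long exact sequences of 0 → K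
→ X → I → 0 and 0 → I → Y → C → 0 give the same for K and C. Closure under extensions is the middle
term of such a sequence and does not need hereditariness. -/

namespace UnivLoc

/-! ### Hereditary rings: submodules of free modules, coherence, projective dimension -/

section Hereditary

variable {A : Type u} [Ring A]

/-- If all submodules of two modules are projective, so are those of their product. -/
lemma projective_submodule_prod {M N : Type u} [AddCommGroup M] [Module A M] [AddCommGroup N]
    [Module A N] (hM : ∀ L : Submodule A M, Module.Projective A L)
    (hN : ∀ L : Submodule A N, Module.Projective A L) (L : Submodule A (M × N)) :
    Module.Projective A L := by
  let g : L →ₗ[A] M := LinearMap.fst A M N ∘ₗ L.subtype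
  -- The image of L in M is projective, so L is the sum of this image and the kernel of the
  -- projection; the kernel embeds in N by the second coordinate.
  have := hM (LinearMap.range g)
  obtain ⟨s, hs⟩ := Module.projective_lifting_property g.rangeRestrict .id
    g.surjective_rangeRestrict
  let k : LinearMap.ker g.rangeRestrict →ₗ[A] N :=
    LinearMap.snd A M N ∘ₗ L.subtype ∘ₗ (LinearMap.ker g.rangeRestrict).subtype
  have hk : Function.Injective k := by
    intro x y h
    have hx := congrArg Subtype.val (LinearMap.mem_ker.1 x.2)
    have hy := congrArg Subtype.val (LinearMap.mem_ker.1 y.2)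
    exact Subtype.ext (Subtype.ext (Prod.ext (hx.trans hy.symm) h))
  have := hN (LinearMap.range k)
  have := Module.Projective.of_equiv (LinearEquiv.ofInjective k hk).symm
  refine Module.Projective.of_split
    (LinearMap.prod (LinearMap.codRestrict (LinearMap.ker g.rangeRestrict)
      (LinearMap.id - s ∘ₗ g.rangeRestrict) fun x => ?_) g.rangeRestrict)
    (LinearMap.coprod (LinearMap.ker g.rangeRestrict).subtype s) ?_
  · have := DFunLike.congr_fun hs (g.rangeRestrict x)
    rw [LinearMap.mem_ker, LinearMap.sub_apply, map_sub, sub_eq_zero]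
    exact this.symm
  · ext1 x
    simp

/-- The submodules of a free module of finite rank over a hereditary ring are projective. -/
lemma projective_submodule_pi (hA : ∀ I : Submodule A A, Module.Projective A I) (n : ℕ)
    (L : Submodule A (Fin n → A)) : Module.Projective A L := by
  induction n with
  | zero => infer_instance
  | succ n ih =>
    let e : (Fin (n + 1) → A) ≃ₗ[A] A × (Fin n → A) := (Fin.consLinearEquiv A fun _ => A).symm
    have := projective_submodule_prod hA ih (L.map e.toLinearMap)
    exact Module.Projective.of_equiv (e.submoduleMap L).symm

/-- A hereditary ring is coherent. -/
lemma finitePresentation_of_fg (hA : ∀ I : Submodule A A, Module.Projective A I) {M : Type u}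
    [AddCommGroup M] [Module A M] [Module.FinitePresentation A M] (L : Submodule A M)
    (hL : L.FG) : Module.FinitePresentation A L := by
  obtain ⟨n, π, hπ⟩ := Module.Finite.exists_fin' A M
  have hker : (LinearMap.ker π).FG := Module.FinitePresentation.fg_ker π hπ
  -- The preimage of L in the free module is projective, and finitely generated because L and ker π
  -- are; so it is finitely presented. L is its quotient by a copy of ker π.
  have := projective_submodule_pi hA n (L.comap π)
  have hfg : (L.comap π).FG := by
    refine Submodule.fg_of_fg_map_of_fg_inf_ker π ?_ ?_
    · rwa [Submodule.map_comap_eq_of_surjective hπ]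
    · rwa [inf_eq_right.2 (LinearMap.ker_le_comap π)]
  have : Module.Finite A (L.comap π) := .of_fg hfg
  have := Module.finitePresentation_of_projective A (L.comap π)
  let ρ : L.comap π →ₗ[A] L := π.restrict fun _ h => h
  refine Module.finitePresentation_of_surjective ρ (fun x => ?_) ?_
  · obtain ⟨y, hy⟩ := hπ x
    exact ⟨⟨y, show π y ∈ L from hy ▸ x.2⟩, Subtype.ext hy⟩
  · refine Submodule.fg_of_fg_map_injective (L.comap π).subtype Subtype.val_injective ?_
    convert hker
    ext x
    constructor
    · rintro ⟨y, hy, rfl⟩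
      exact congrArg Subtype.val (LinearMap.mem_ker.1 hy)
    · intro hx
      exact ⟨⟨x, LinearMap.ker_le_comap π hx⟩, Subtype.ext hx, rfl⟩

lemma finitePresentation_range (hA : ∀ I : Submodule A A, Module.Projective A I) {M N : Type u}
    [AddCommGroup M] [Module A M] [AddCommGroup N] [Module A N] [Module.Finite A M]
    [Module.FinitePresentation A N] (f : M →ₗ[A] N) :
    Module.FinitePresentation A (LinearMap.range f) :=
  finitePresentation_of_fg hA _ (Submodule.fg_range f)

/-- Coherence is used twice: the image is finitely presented, so the kernel is finitely generated,
and hence finitely presented as a submodule of M. -/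
lemma finitePresentation_ker (hA : ∀ I : Submodule A A, Module.Projective A I) {M N : Type u}
    [AddCommGroup M] [Module A M] [AddCommGroup N] [Module A N] [Module.FinitePresentation A M]
    [Module.FinitePresentation A N] (f : M →ₗ[A] N) :
    Module.FinitePresentation A (LinearMap.ker f) := by
  have := finitePresentation_range hA f
  refine finitePresentation_of_fg hA _ ?_
  rw [← LinearMap.ker_rangeRestrict]
  exact Module.FinitePresentation.fg_ker _ f.surjective_rangeRestrict

lemma finitePresentation_coker {M N : Type u} [AddCommGroup M] [Module A M] [AddCommGroup N]
    [Module A N] [Module.Finite A M] [Module.FinitePresentation A N] (f : M →ₗ[A] N) :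
    Module.FinitePresentation A (N ⧸ LinearMap.range f) :=
  Module.finitePresentation_of_surjective _ (Submodule.mkQ_surjective _)
    (by rw [Submodule.ker_mkQ]; exact Submodule.fg_range f)

lemma hasProjectiveDimensionLE_one (hA : ∀ I : Submodule A A, Module.Projective A I)
    (M : ModuleCat.{u} A) [Module.Finite A M] : HasProjectiveDimensionLE M 1 := by
  obtain ⟨n, π, hπ⟩ := Module.Finite.exists_fin' A M
  have := projective_submodule_pi hA n (LinearMap.ker π)
  have h := LinearMap.shortExact_shortComplexKer hπ
  -- Dimension at most 1 means `HasProjectiveDimensionLT` with bound 2; the projective kernel has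
  -- bound 1.
  refine h.hasProjectiveDimensionLT_X₃ 1 ?_ ?_
  · have : Projective (ModuleCat.of A (LinearMap.ker π)) := inferInstance
    exact inferInstanceAs (HasProjectiveDimensionLT (ModuleCat.of A (LinearMap.ker π)) 1)
  · exact inferInstanceAs (HasProjectiveDimensionLT (ModuleCat.of A (Fin n → A)) 2)

end Hereditary

/-- `MulOpposite.op` is linear over `Rᵐᵒᵖ` and matches right ideals of R with left ideals of `Rᵐᵒᵖ`,
so the results above apply with A = `Rᵐᵒᵖ`. -/
lemma IsRightHereditary.projective {R : Type u} [Ring R] (hR : IsRightHereditary R)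
    (I : Submodule Rᵐᵒᵖ Rᵐᵒᵖ) : Module.Projective Rᵐᵒᵖ I := by
  let e : R ≃ₗ[Rᵐᵒᵖ] Rᵐᵒᵖ :=
    { MulOpposite.opAddEquiv with map_smul' := fun _ _ => rfl }
  have := hR (I.map e.symm.toLinearMap)
  exact Module.Projective.of_equiv (e.symm.submoduleMap I).symm

/-! ### Vanishing in the contravariant long exact sequence of Ext -/

section Ext

open Abelian

variable {C : Type*} [Category* C] [Abelian C] [HasExt.{v} C] {S : ShortComplex C}
  (hS : S.ShortExact) (N : C)

include hS

lemma subsingleton_ext_X₂ {i : ℕ} [Subsingleton (Ext.{v} S.X₁ N i)]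
    [Subsingleton (Ext.{v} S.X₃ N i)] : Subsingleton (Ext.{v} S.X₂ N i) := by
  refine subsingleton_of_forall_eq 0 fun x => ?_
  obtain ⟨y, rfl⟩ := Ext.contravariant_sequence_exact₂ hS N x (Subsingleton.elim _ _)
  rw [Subsingleton.elim y 0, Ext.comp_zero]

/-- The connecting map is composition with the degree 1 class of S, whence the form `1 + i` of the
degree. -/
lemma subsingleton_ext_X₁ (i : ℕ) [Subsingleton (Ext.{v} S.X₂ N i)]
    [Subsingleton (Ext.{v} S.X₃ N (1 + i))] : Subsingleton (Ext.{v} S.X₁ N i) := by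
  refine subsingleton_of_forall_eq 0 fun x => ?_
  obtain ⟨y, rfl⟩ := Ext.contravariant_sequence_exact₁ hS N x rfl (Subsingleton.elim _ _)
  rw [Subsingleton.elim y 0, Ext.comp_zero]

lemma subsingleton_ext_X₃ (i : ℕ) [Subsingleton (Ext.{v} S.X₁ N i)]
    [Subsingleton (Ext.{v} S.X₂ N (1 + i))] : Subsingleton (Ext.{v} S.X₃ N (1 + i)) := by
  refine subsingleton_of_forall_eq 0 fun x => ?_
  obtain ⟨y, rfl⟩ := Ext.contravariant_sequence_exact₃ hS N x (Subsingleton.elim _ _) rfl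
  rw [Subsingleton.elim y 0, Ext.comp_zero]

lemma subsingleton_ext_zero_X₃ [Subsingleton (Ext.{v} S.X₂ N 0)] :
    Subsingleton (Ext.{v} S.X₃ N 0) :=
  have := hS.epi_g
  (Ext.precomp_mk₀_injective_of_epi N S.g).subsingleton

end Ext

/-! ### Perpendicularity of images, kernels and cokernels -/

section LeftPerp

open Abelian

variable {A : Type u} [Ring A] {N : ModuleCat.{u} A}

/-- Treating Hom as Ext⁰ lets both conditions be read off one long exact sequence. -/
lemma leftPerp_iff {M : ModuleCat.{u} A} :
    LeftPerp M N ↔ Subsingleton (Ext.{u} M N 0) ∧ Subsingleton (Ext.{u} M N 1) :=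
  and_congr_left' (Ext.homEquiv₀ (X := M) (Y := N)).symm.subsingleton_congr

lemma LeftPerp.of_iso {M M' : ModuleCat.{u} A} (e : M ≅ M') (h : LeftPerp M N) :
    LeftPerp M' N := by
  have := h.1
  have := h.2
  refine ⟨e.symm.homFromEquiv.subsingleton, ?_⟩
  refine subsingleton_of_forall_eq 0 fun x => ?_
  have hx : (Ext.mk₀ e.inv).comp ((Ext.mk₀ e.hom).comp x (zero_add 1)) (zero_add 1) = x := by
    simp
  rw [← hx, Subsingleton.elim ((Ext.mk₀ e.hom).comp x (zero_add 1)) 0, Ext.comp_zero]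

lemma LeftPerp.X₂ {S : ShortComplex (ModuleCat.{u} A)} (hS : S.ShortExact)
    (h₁ : LeftPerp S.X₁ N) (h₃ : LeftPerp S.X₃ N) : LeftPerp S.X₂ N := by
  rw [leftPerp_iff] at *
  obtain ⟨_, _⟩ := h₁
  obtain ⟨_, _⟩ := h₃
  exact ⟨subsingleton_ext_X₂ hS N, subsingleton_ext_X₂ hS N⟩

variable {X Y : ModuleCat.{u} A} (f : X ⟶ Y)

lemma shortExact_range : (ShortComplex.moduleCatMk (LinearMap.range f.hom).subtype
    (LinearMap.range f.hom).mkQ (by ext; simp)).ShortExact where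
  exact := ShortComplex.Exact.moduleCat_of_range_eq_ker _ _ (by simp)
  mono_f := (ModuleCat.mono_iff_injective _).2 (Submodule.subtype_injective _)
  epi_g := (ModuleCat.epi_iff_surjective _).2 (Submodule.mkQ_surjective _)

lemma leftPerp_range (hC : HasProjectiveDimensionLE (ModuleCat.of A (Y ⧸ LinearMap.range f.hom)) 1)
    (hX : LeftPerp X N) (hY : LeftPerp Y N) :
    LeftPerp (ModuleCat.of A (LinearMap.range f.hom)) N := by
  rw [leftPerp_iff] at *
  obtain ⟨_, _⟩ := hX
  obtain ⟨_, _⟩ := hY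
  constructor
  · exact @subsingleton_ext_zero_X₃ _ _ _ _ _
      (LinearMap.shortExact_shortComplexKer f.hom.surjective_rangeRestrict) N ‹_›
  · have : Subsingleton (Ext.{u} (ModuleCat.of A (Y ⧸ LinearMap.range f.hom)) N 2) :=
      HasProjectiveDimensionLT.subsingleton _ 2 _ le_rfl N
    exact @subsingleton_ext_X₁ _ _ _ _ _ (shortExact_range f) N 1 ‹_› this

lemma leftPerp_ker (hI : HasProjectiveDimensionLE (ModuleCat.of A (LinearMap.range f.hom)) 1)
    (hX : LeftPerp X N) (hI' : LeftPerp (ModuleCat.of A (LinearMap.range f.hom)) N) :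
    LeftPerp (ModuleCat.of A (LinearMap.ker f.hom)) N := by
  -- The kernel is now that of the surjection X → I, which is the form the short exact sequence
  -- requires.
  rw [← LinearMap.ker_rangeRestrict]
  rw [leftPerp_iff] at *
  obtain ⟨_, _⟩ := hX
  have h := LinearMap.shortExact_shortComplexKer f.hom.surjective_rangeRestrict
  have : Subsingleton (Ext.{u} (ModuleCat.of A (LinearMap.range f.hom)) N 2) :=
    HasProjectiveDimensionLT.subsingleton _ 2 _ le_rfl N
  exact ⟨@subsingleton_ext_X₁ _ _ _ _ _ h N 0 ‹_› hI'.2,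
    @subsingleton_ext_X₁ _ _ _ _ _ h N 1 ‹_› this⟩

/-- Ext¹(C, N) lies between Hom(I, N) and Ext¹(Y, N), so no Ext² is involved. -/
lemma leftPerp_coker (hY : LeftPerp Y N)
    (hI : LeftPerp (ModuleCat.of A (LinearMap.range f.hom)) N) :
    LeftPerp (ModuleCat.of A (Y ⧸ LinearMap.range f.hom)) N := by
  rw [leftPerp_iff] at *
  obtain ⟨_, _⟩ := hY
  exact ⟨@subsingleton_ext_zero_X₃ _ _ _ _ _ (shortExact_range f) N ‹_›,
    @subsingleton_ext_X₃ _ _ _ _ _ (shortExact_range f) N 0 hI.1 ‹_›⟩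

end LeftPerp

/-! ### Closure properties of the trivial modules -/

section Closure

variable {R : Type u} [Ring R] {ι : Type u} (Sig : ι → ProjMap R)

instance : (trivialModules Sig).IsClosedUnderIsomorphisms where
  of_iso {M M'} e := fun ⟨h₁, h₂, h₃⟩ => by
    have : Module.FinitePresentation Rᵐᵒᵖ M := h₁
    exact ⟨Module.FinitePresentation.of_equiv e.toLinearEquiv,
      hasProjectiveDimensionLT_of_iso e 2, fun N => (h₃ N).of_iso e⟩

instance : (trivialModules Sig).ContainsZero where
  exists_zero := by
    refine ⟨ModuleCat.of _ PUnit, ModuleCat.isZero_of_subsingleton _,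
      inferInstanceAs (Module.FinitePresentation Rᵐᵒᵖ PUnit.{u + 1}), ?_, fun N => ⟨?_, ?_⟩⟩
    · have : Projective (ModuleCat.of Rᵐᵒᵖ PUnit.{u + 1}) := inferInstance
      infer_instance
    · exact ⟨(ModuleCat.isZero_of_subsingleton _).eq_of_src⟩
    · have : Projective (ModuleCat.of Rᵐᵒᵖ PUnit.{u + 1}) := inferInstance
      exact HasProjectiveDimensionLT.subsingleton _ 1 _ le_rfl _

instance : (trivialModules Sig).IsClosedUnderExtensions where
  prop_X₂_of_shortExact {S} hS h₁ h₃ := by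
    have : Module.FinitePresentation Rᵐᵒᵖ S.X₁ := h₁.1
    have : Module.FinitePresentation Rᵐᵒᵖ S.X₃ := h₃.1
    refine ⟨?_, hS.hasProjectiveDimensionLT_X₂ 2 h₁.2.1 h₃.2.1,
      fun N => (h₁.2.2 N).X₂ hS (h₃.2.2 N)⟩
    -- An extension of finitely presented modules is finitely presented, once the subobject is
    -- identified with the kernel of g.
    let e : S.X₁ ≃ₗ[Rᵐᵒᵖ] LinearMap.ker S.g.hom :=
      LinearEquiv.ofInjective S.f.hom ((ModuleCat.mono_iff_injective _).1 hS.mono_f) ≪≫ₗ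
        LinearEquiv.ofEq _ _ hS.exact.moduleCat_range_eq_ker
    have := Module.FinitePresentation.of_equiv e
    exact Module.finitePresentation_of_ker S.g.hom ((ModuleCat.epi_iff_surjective _).1 hS.epi_g)

/-- A biproduct is a split extension; with the zero object, binary products give all finite ones. -/
instance : (trivialModules Sig).IsClosedUnderFiniteProducts :=
  have : (trivialModules Sig).IsClosedUnderBinaryProducts :=
    .mk' (by
      rintro _ ⟨F, hF⟩
      exact (trivialModules Sig).prop_of_iso
        ((Limits.biprod.isoProd _ _) ≪≫ (HasLimit.isoOfNatIso (diagramIsoPair F)).symm)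
        ((trivialModules Sig).prop_biprod (hF ⟨.left⟩) (hF ⟨.right⟩)))
  .mk'

variable (hR : IsRightHereditary R) {X Y : ModuleCat.{u} Rᵐᵒᵖ} (f : X ⟶ Y)
  (hX : trivialModules Sig X) (hY : trivialModules Sig Y)
include hR hX hY

lemma trivialModules_range : trivialModules Sig (ModuleCat.of _ (LinearMap.range f.hom)) := by
  have : Module.FinitePresentation Rᵐᵒᵖ X := hX.1
  have : Module.FinitePresentation Rᵐᵒᵖ Y := hY.1
  exact ⟨finitePresentation_range hR.projective f.hom, hasProjectiveDimensionLE_one hR.projective _,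
    fun N => leftPerp_range f (hasProjectiveDimensionLE_one hR.projective _) (hX.2.2 N) (hY.2.2 N)⟩

lemma trivialModules_ker : trivialModules Sig (ModuleCat.of _ (LinearMap.ker f.hom)) := by
  have : Module.FinitePresentation Rᵐᵒᵖ X := hX.1
  have : Module.FinitePresentation Rᵐᵒᵖ Y := hY.1
  have := finitePresentation_ker hR.projective f.hom
  have h := trivialModules_range Sig hR f hX hY
  exact ⟨this, hasProjectiveDimensionLE_one hR.projective _,
    fun N => leftPerp_ker f h.2.1 (hX.2.2 N) (h.2.2 N)⟩

lemma trivialModules_coker : trivialModules Sig (ModuleCat.of _ (Y ⧸ LinearMap.range f.hom)) := by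
  have : Module.FinitePresentation Rᵐᵒᵖ X := hX.1
  have : Module.FinitePresentation Rᵐᵒᵖ Y := hY.1
  exact ⟨finitePresentation_coker f.hom, hasProjectiveDimensionLE_one hR.projective _,
    fun N => leftPerp_coker f (hY.2.2 N) ((trivialModules_range Sig hR f hX hY).2.2 N)⟩

omit hX hY

lemma isClosedUnderKernels_trivialModules : (trivialModules Sig).IsClosedUnderKernels where
  kernels_le := by
    rintro _ ⟨f, k, hk, hX, hY⟩
    exact (trivialModules Sig).prop_of_iso ((ModuleCat.kernelIsLimit f).conePointUniqueUpToIso hk)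
      (trivialModules_ker Sig hR f hX hY)

lemma isClosedUnderCokernels_trivialModules : (trivialModules Sig).IsClosedUnderCokernels where
  cokernels_le := by
    rintro _ ⟨f, k, hk, hX, hY⟩
    exact (trivialModules Sig).prop_of_iso
      ((ModuleCat.cokernelIsColimit f).coconePointUniqueUpToIso hk)
      (trivialModules_coker Sig hR f hX hY)

end Closure

/-! ### From closure properties to an exact abelian subcategory -/

/-- In an abelian category, a full subcategory that contains zero and is closed under finite
products, kernels and cokernels is an exact abelian subcategory of each full subcategory that
contains it. -/
lemma isExactAbelianSubcategory_of_le {C : Type*} [Category* C] [Abelian C]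
    {P Q : ObjectProperty C} (h : P ≤ Q) [P.ContainsZero] [P.IsClosedUnderFiniteProducts]
    [P.IsClosedUnderKernels] [P.IsClosedUnderCokernels] : IsExactAbelianSubcategory P Q where
  le := h
  abelian := ⟨inferInstance, rfl⟩
  preservesFiniteLimits := by
    -- Exactness is tested in the ambient category: `Q.ι` is fully faithful, so it reflects limits
    -- and colimits, and the composite with it is `P.ι`.
    have := P.preservesKernels_ι
    have : PreservesFiniteLimits P.ι := Functor.preservesFiniteLimits_of_preservesKernels P.ι
    have : PreservesFiniteLimits (ObjectProperty.ιOfLE h ⋙ Q.ι) := this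
    exact preservesFiniteLimits_of_reflects_of_preserves _ Q.ι
  preservesFiniteColimits := by
    have := P.preservesCokernels_ι
    have : PreservesFiniteColimits P.ι := Functor.preservesFiniteColimits_of_preservesCokernels P.ι
    have : PreservesFiniteColimits (ObjectProperty.ιOfLE h ⋙ Q.ι) := this
    exact preservesFiniteColimits_of_reflects_of_preserves _ Q.ι

end UnivLoc

theorem mainTheorem5 (R : Type u) [Ring R] (hR : UnivLoc.IsRightHereditary R)
    {ι : Type u} (Sig : ι → UnivLoc.ProjMap R) :
    UnivLoc.IsExactAbelianSubcategory (UnivLoc.trivialModules Sig) (UnivLoc.fpMod R) ∧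
      UnivLoc.IsClosedUnderKerCokerIm (UnivLoc.trivialModules Sig) ∧
      (UnivLoc.trivialModules Sig).IsClosedUnderExtensions := by
  have := UnivLoc.isClosedUnderKernels_trivialModules Sig hR
  have := UnivLoc.isClosedUnderCokernels_trivialModules Sig hR
  exact ⟨UnivLoc.isExactAbelianSubcategory_of_le fun _ h => h.1,
    ⟨inferInstance, inferInstance, inferInstance, inferInstance,
      fun _ _ f hX hY => UnivLoc.trivialModules_range Sig hR f hX hY⟩, inferInstance⟩
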